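/- A germ $f(z)=e^{2\pi i\alpha}z+O(z^2)$ of holomorphic diffeomorphism at $0\in\mathbb C$, with $\alpha\in\mathbb R\setminus\mathbb Q$, is called linearizable if there is a holomorphic germ $h(w)=w+O(w^2)$ with $f\circ h=h\circ R_\alpha$ near $0$, where $R_\alpha(w)=e^{2\pi i\alpha}w$, and nonlinearizable otherwise; a linearization domain of $f$ is a set $h(\{|w|<r\})$, $r>0$, with such an $h$ that is univalent on $\{|w|<r\}$. A Siegel compact of $f$ is a compact connected set $K\subset\mathbb C$ with connected complement and $\{0\}\subsetneq K$, such that $f$ and $f^{-1}$ extend univalently to a neighbourhood of $K$ and $f(K)=f^{-1}(K)=K$. A hedgehog of $f$ is a Siegel compact of $f$ that is not contained in the closure of any linearization domain of $f$. **Theorem 3.1.** Let $K$ be a hedgehog of a nonlinearizable germ $f$. Suppose that a holomorphic germ $T(z)=z+O(z^2)$ tangent to the identity extends univalently to a neighbourhood of $K$, and that $K$ is forward invariant under $T$ ($T(K)\subseteq K$) or backward invariant under $T$ ($T^{-1}(K)\subseteq K$, that is, $K\subseteq T(K)$). Then $T$ is the identity, i.e. $T(z)=z$ for all $z$ near $0$.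 -/

import Mathlib

open Set Filter Topology

/-- `f` represents a germ at `0` of the form `f(z) = e^{2πiα} z + O(z²)`, holomorphic near `0`,
with `α` real and irrational. -/
def IsIrrationallyIndifferentGerm (f : ℂ → ℂ) : Prop :=
  AnalyticAt ℂ f 0 ∧ f 0 = 0 ∧
    ∃ α : ℝ, Irrational α ∧ deriv f 0 = Complex.exp (2 * Real.pi * Complex.I * α)

/-- `h` represents a germ `h(w) = w + O(w²)` of holomorphic change of variables which conjugates
the germ `f` to its linear part `R(w) = f'(0) w`, that is, `f ∘ h = h ∘ R` near `0`. -/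
def LinearizesGerm (f h : ℂ → ℂ) : Prop :=
  AnalyticAt ℂ h 0 ∧ h 0 = 0 ∧ deriv h 0 = 1 ∧ ∀ᶠ w in 𝓝 (0 : ℂ), f (h w) = h (deriv f 0 * w)

/-- The germ `f` is linearizable. -/
def IsLinearizableGerm (f : ℂ → ℂ) : Prop :=
  ∃ h : ℂ → ℂ, LinearizesGerm f h

/-- `D` is a linearization domain of the germ `f`: the image `h({|w| < r})` of a round disk under a
linearizing map `h` which is univalent on that disk.  (If `|f'(0)| = 1`, the germ `f` is then
continued to all of `D` by `h ∘ R ∘ h⁻¹`.) -/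
def IsLinearizationDomain (f : ℂ → ℂ) (D : Set ℂ) : Prop :=
  ∃ (h : ℂ → ℂ) (r : ℝ), 0 < r ∧ LinearizesGerm f h ∧
    DifferentiableOn ℂ h (Metric.ball 0 r) ∧ InjOn h (Metric.ball 0 r) ∧
    D = h '' Metric.ball 0 r

/-- `F` is a univalent (holomorphic and injective) extension of the germ at `0` represented by `g`
to a neighbourhood of the set `K`.  When `K` is connected and contains `0`, the values of `F` near
`K` are determined by the germ. -/
def IsUnivalentExtensionNear (g F : ℂ → ℂ) (K : Set ℂ) : Prop :=
  F =ᶠ[𝓝 0] g ∧ ∃ U : Set ℂ, IsOpen U ∧ K ⊆ U ∧ DifferentiableOn ℂ F U ∧ InjOn F U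

/-- `K` is a Siegel compact of the germ `f`: a full connected compact set strictly containing `{0}`
such that `f` and the inverse germ `f⁻¹` extend univalently (as `F` and `G`) to a neighbourhood of
`K`, and `f(K) = f⁻¹(K) = K`. -/
def IsSiegelCompact (f : ℂ → ℂ) (K : Set ℂ) : Prop :=
  IsCompact K ∧ IsConnected K ∧ IsConnected Kᶜ ∧ {0} ⊂ K ∧
    ∃ F G finv : ℂ → ℂ,
      (finv 0 = 0 ∧ AnalyticAt ℂ finv 0 ∧
        (∀ᶠ z in 𝓝 (0 : ℂ), finv (f z) = z) ∧ ∀ᶠ z in 𝓝 (0 : ℂ), f (finv z) = z) ∧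
      IsUnivalentExtensionNear f F K ∧ IsUnivalentExtensionNear finv G K ∧
      F '' K = K ∧ G '' K = K

/-- `K` is a hedgehog of the germ `f`: the rotation number of `f` is irrational and `K` is a Siegel
compact of `f` which is not contained in the closure of any linearization domain of `f`. -/
def IsHedgehog (f : ℂ → ℂ) (K : Set ℂ) : Prop :=
  IsIrrationallyIndifferentGerm f ∧ IsSiegelCompact f K ∧
    ¬ ∃ D : Set ℂ, IsLinearizationDomain f D ∧ K ⊆ closure D

/-!
The argument is local at `0` and elementary. Suppose that `T(z) = z + a zᵐ⁺¹ + ⋯` with `a ≠ 0`;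
in the backward invariant case `T` is replaced by its inverse germ, so that `K` is always forward
invariant under `T`. The claim is that `K` is then a neighbourhood of `0`. This contradicts
nonlinearizability: the iterates of `f` are bounded on a disk contained in the invariant compact
`K`, so limits of the averages `(1 / n) ∑ λ⁻ʲ fʲ` linearize `f`
(`isLinearizableGerm_of_mem_interior`).

The two dynamics interact at well chosen scales. The continuum `K` meets every small circle around
`0`, and `f` rotates it. If `p / q` is a good rational approximation of the rotation number, then
`q` iterates of the rotation are `4π / q`-dense in the circle; after passing to a normal form
`λ z + O(zᴺ)` with `N` large, `q` iterates of `f` are indistinguishable from those of the rotation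
at radius `r = q ^ (-1 / (m + 1))`. At this scale `1 / q = rᵐ⁺¹`, so `K` leaves gaps of size
`O(rᵐ⁺²)` only, which is negligible compared with the step `|a| rᵐ⁺¹` of `T`
(`exists_scale_dense`).

On a repelling petal, the inverse branch of `T` carries every point `z` to such a scale, where a
point of `K` lies within a tiny fraction of a step of `T`. Distances measured in units of
`|z|ᵐ⁺¹` are distorted by a bounded factor along the whole orbit, because the sum of `|zₖ|ᵐ⁺¹` is
controlled by the telescoping sum of `|zₖ| - |zₖ₊₁|`. Pushing the point of `K` forward by `T` thus
gives points of `K` arbitrarily close to `z`, and the whole petal lies in `K`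
(`eventually_repellingSector_mem`). Finitely many iterates of `f` rotate the petal over all
directions (`mem_nhds_of_repellingSector_subset`).
-/


/-! ### Equidistribution of an irrational rotation along a short orbit -/

/-- For arbitrarily large `q`, namely the denominators of the good rational approximations of `α`,
the first `q` multiples of `α` are `2 / q`-dense modulo `1`. -/
lemma Irrational.exists_dense_multiples {α : ℝ} (hα : Irrational α) (N : ℕ) :
    ∃ q : ℕ, N ≤ q ∧ 0 < q ∧ ∀ x : ℝ, ∃ j < q, ∃ n : ℤ, |(j : ℝ) * α - x - n| ≤ 2 / q := by
  have hinf := Real.infinite_rat_abs_sub_lt_one_div_den_sq_of_irrational hα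
  obtain ⟨r, hr, hrN⟩ : ∃ r : ℚ, |α - r| < 1 / (r.den : ℝ) ^ 2 ∧ N ≤ r.den := by
    by_contra! hcon
    refine hinf (Set.Finite.subset (s := (fun ab : ℤ × ℕ => (ab.1 : ℚ) / (ab.2 : ℚ)) ''
      (Set.Icc (-⌈(|α| + 1) * N⌉) ⌈(|α| + 1) * N⌉ ×ˢ Set.Iio N))
      (((Set.finite_Icc _ _).prod (Set.finite_Iio N)).image _) ?_)
    intro r hr
    have hrd := hcon r hr
    refine ⟨(r.num, r.den), ⟨?_, hrd⟩, Rat.num_div_den r⟩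
    have hden : (1 : ℝ) ≤ r.den := by exact_mod_cast r.pos
    have h1 : |α - r| < 1 := by
      refine lt_of_lt_of_le hr ?_
      rw [div_le_one (by positivity)]
      nlinarith
    have h2 : |(r : ℝ)| ≤ |α| + 1 := by
      have := abs_sub_abs_le_abs_sub (r : ℝ) α
      rw [abs_sub_comm] at this
      linarith
    have h3 : |(r.num : ℝ)| ≤ (|α| + 1) * N := by
      have h4 : (r.num : ℝ) = r * r.den := by
        exact_mod_cast (Rat.mul_den_eq_num r).symm
      rw [h4, abs_mul, Nat.abs_cast]
      have h5 : (r.den : ℝ) ≤ N := by exact_mod_cast hrd.le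
      gcongr
    have h6 := h3.trans (Int.le_ceil _)
    rw [abs_le] at h6
    constructor
    · exact_mod_cast h6.1
    · exact_mod_cast h6.2
  refine ⟨r.den, hrN, r.pos, fun x => ?_⟩
  have hq : (0 : ℝ) < r.den := by exact_mod_cast r.pos
  set q := r.den with hqdef
  -- Solve `j * r.num ≡ round (q * x)` modulo `q`.
  obtain ⟨j, hjq, n, hjn⟩ : ∃ j < q, ∃ n : ℤ, (j : ℤ) * r.num = round (q * x) + q * n := by
    have : NeZero q := ⟨r.den_nz⟩
    have hcop : IsCoprime r.num (q : ℤ) := by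
      rw [Int.isCoprime_iff_gcd_eq_one]
      exact r.reduced
    obtain ⟨a, b, hab⟩ := hcop
    refine ⟨((round (q * x) * a) % (q : ℤ)).toNat, ?_, ?_⟩
    · have h1 := Int.emod_lt_of_pos (round (q * x) * a) (by exact_mod_cast r.pos : (0 : ℤ) < q)
      have h2 := Int.emod_nonneg (round (q * x) * a) (by exact_mod_cast r.den_nz : (q : ℤ) ≠ 0)
      omega
    · have h2 := Int.emod_nonneg (round (q * x) * a) (by exact_mod_cast r.den_nz : (q : ℤ) ≠ 0)
      rw [Int.toNat_of_nonneg h2]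
      have h3 := Int.emod_add_mul_ediv (round (q * x) * a) q
      refine ⟨-(round (q * x) * b) - (round (q * x) * a / q) * r.num, ?_⟩
      linear_combination r.num * h3 + round (q * x) * hab
  refine ⟨j, hjq, n, ?_⟩
  have hr0 : (r : ℝ) = r.num / q := by
    exact_mod_cast (Rat.num_div_den r).symm
  have hjn' : (j : ℝ) * r.num = round (q * x) + q * n := by exact_mod_cast hjn
  have key : (j : ℝ) * α - x - n = j * (α - r) + (round (q * x) - q * x) / q := by
    rw [hr0]
    generalize (round (q * x) : ℝ) = t at hjn' ⊢
    field_simp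
    linear_combination hjn'
  have e1 : |(j : ℝ) * (α - r)| ≤ 1 / q := by
    rw [abs_mul, Nat.abs_cast]
    have : (j : ℝ) ≤ q := by exact_mod_cast hjq.le
    calc (j : ℝ) * |α - r| ≤ q * (1 / (q : ℝ) ^ 2) := by gcongr
      _ = 1 / q := by field_simp
  have e2 : |((round (q * x) : ℝ) - q * x) / q| ≤ 1 / q := by
    rw [abs_div, abs_of_pos hq]
    gcongr
    rw [abs_sub_comm]
    exact (abs_sub_round _).trans (by norm_num)
  rw [key]
  calc _ ≤ _ := abs_add_le _ _
    _ ≤ 1 / (q : ℝ) + 1 / q := add_le_add e1 e2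
    _ = 2 / q := by ring

/-- For arbitrarily large `q`, the first `q` powers of `λ = e^{2πiα}` are `4π / q`-dense in the
unit circle. -/
lemma Irrational.exists_dense_powers {α : ℝ} (hα : Irrational α) (N : ℕ) :
    ∃ q : ℕ, N ≤ q ∧ 0 < q ∧ ∀ v : ℂ, ‖v‖ = 1 →
      ∃ j < q, ‖Complex.exp (2 * Real.pi * Complex.I * α) ^ j - v‖ ≤ 4 * Real.pi / q := by
  obtain ⟨q, hNq, hq, h⟩ := hα.exists_dense_multiples N
  refine ⟨q, hNq, hq, fun v hv => ?_⟩
  obtain ⟨j, hj, n, hjn⟩ := h (v.arg / (2 * Real.pi))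
  refine ⟨j, hj, ?_⟩
  have hpi := Real.pi_pos
  have hv' : v = Complex.exp (v.arg * Complex.I) := by
    have := Complex.norm_mul_exp_arg_mul_I v
    rw [hv] at this
    simpa using this.symm
  set θ : ℝ := 2 * Real.pi * ((j : ℝ) * α - v.arg / (2 * Real.pi) - n) with hθ
  have e : Complex.exp (2 * Real.pi * Complex.I * α) ^ j = v * Complex.exp (Complex.I * θ) := by
    conv_rhs => rw [hv']
    rw [← Complex.exp_nat_mul, ← Complex.exp_add]
    rw [Complex.exp_eq_exp_iff_exists_int]
    refine ⟨n, ?_⟩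
    rw [hθ]
    have : (Real.pi : ℂ) ≠ 0 := by exact_mod_cast hpi.ne'
    push_cast
    field_simp
    ring
  rw [e, show v * Complex.exp (Complex.I * θ) - v = v * (Complex.exp (Complex.I * θ) - 1) by ring,
    norm_mul, hv, one_mul]
  refine (Real.norm_exp_I_mul_ofReal_sub_one_le).trans ?_
  rw [hθ, Real.norm_eq_abs, abs_mul, abs_of_pos (by positivity : 0 < 2 * Real.pi)]
  calc _ ≤ 2 * Real.pi * (2 / q) := by gcongr
    _ = _ := by ring

/-- An irrational rotation number has no resonances: this is what makes every finite order
normal form available. -/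
lemma Irrational.exp_pow_ne_self {α : ℝ} (hα : Irrational α) (k : ℕ) (hk : 2 ≤ k) :
    Complex.exp (2 * Real.pi * Complex.I * α) ^ k ≠ Complex.exp (2 * Real.pi * Complex.I * α) := by
  intro h
  rw [← Complex.exp_nat_mul, Complex.exp_eq_exp_iff_exists_int] at h
  obtain ⟨n, hn⟩ := h
  have hpi : (Real.pi : ℂ) ≠ 0 := by exact_mod_cast Real.pi_ne_zero
  have h1 : ((k : ℂ) - 1) * α = n := by
    have h2 : (2 * (Real.pi : ℂ) * Complex.I) * (((k : ℂ) - 1) * α)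
        = (2 * (Real.pi : ℂ) * Complex.I) * n := by linear_combination hn
    exact mul_left_cancel₀ (by simp [hpi]) h2
  have h3 : (((k : ℤ) - 1 : ℤ) : ℝ) * α = (n : ℤ) := by
    have : (((k : ℝ) - 1) * α : ℝ) = n := by exact_mod_cast h1
    simpa using this
  exact (hα.intCast_mul (m := (k : ℤ) - 1) (by omega)).ne_int n h3

lemma norm_exp_two_pi_I_mul (α : ℝ) : ‖Complex.exp (2 * Real.pi * Complex.I * α)‖ = 1 := by
  rw [show 2 * (Real.pi : ℂ) * Complex.I * α = ((2 * Real.pi * α : ℝ) : ℂ) * Complex.I by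
    push_cast; ring]
  exact Complex.norm_exp_ofReal_mul_I _

/-! ### Local analytic lemmas -/

lemma AnalyticAt.exists_eq_add_mul {g : ℂ → ℂ} (hg : AnalyticAt ℂ g 0) :
    ∃ g₁ : ℂ → ℂ, AnalyticAt ℂ g₁ 0 ∧ g₁ 0 = deriv g 0 ∧ ∀ z, g z = g 0 + z * g₁ z := by
  obtain ⟨p, hp⟩ := hg
  refine ⟨dslope g 0, hp.has_fpower_series_dslope_fslope.analyticAt, dslope_same g 0, fun z => ?_⟩
  have := sub_smul_dslope g 0 z
  rw [sub_zero, smul_eq_mul] at this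
  rw [this]; ring

lemma AnalyticAt.exists_local_inverse {g : ℂ → ℂ} (hg : AnalyticAt ℂ g 0) (h0 : g 0 = 0)
    (h1 : deriv g 0 ≠ 0) :
    ∃ k : ℂ → ℂ, AnalyticAt ℂ k 0 ∧ k 0 = 0 ∧ deriv k 0 = (deriv g 0)⁻¹ ∧
      (∀ᶠ z in 𝓝 0, k (g z) = z) ∧ ∀ᶠ z in 𝓝 0, g (k z) = z := by
  have hs := hg.hasStrictDerivAt
  have e2 := hs.eventually_right_inverse h1
  have e3 := (hs.to_localInverse h1).hasDerivAt.deriv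
  have e4 := hg.analyticAt_localInverse h1
  have e1 := hs.eventually_left_inverse h1
  rw [h0] at e2 e3 e4
  refine ⟨_, e4, ?_, e3, e1, e2⟩
  have := e1.self_of_nhds
  rwa [h0] at this

/-- Second order Taylor estimate for a bounded holomorphic function, with a constant depending only
on the radius and the bound. -/
lemma norm_sub_sub_deriv_mul_le {g : ℂ → ℂ} {R M : ℝ} (hR : 0 < R)
    (hd : DifferentiableOn ℂ g (Metric.ball 0 R)) (hb : ∀ z ∈ Metric.ball (0 : ℂ) R, ‖g z‖ ≤ M)
    {z p : ℂ} (hz : z ∈ Metric.ball (0 : ℂ) (R / 4)) (hp : p ∈ Metric.ball (0 : ℂ) (R / 4)) :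
    ‖g p - g z - deriv g z * (p - z)‖ ≤ M / (R / 4) / (R / 8) * ‖p - z‖ ^ 2 := by
  have hM : 0 ≤ M := (norm_nonneg _).trans (hb 0 (Metric.mem_ball_self hR))
  -- A closed disk centred in a ball is contained in a bigger ball.
  have hsub : ∀ {a b c : ℝ} {w : ℂ}, w ∈ Metric.ball (0 : ℂ) a → a + b ≤ c →
      Metric.closedBall w b ⊆ Metric.ball (0 : ℂ) c := by
    intro a b c w hw habc y hy
    rw [mem_ball_zero_iff] at hw ⊢
    rw [mem_closedBall_iff_norm] at hy
    have := norm_le_insert' y w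
    linarith
  have cauchy : ∀ {k : ℂ → ℂ} {a b c B : ℝ}, 0 < b → a + b ≤ c →
      DifferentiableOn ℂ k (Metric.ball 0 c) → (∀ y ∈ Metric.ball (0 : ℂ) c, ‖k y‖ ≤ B) →
      ∀ w ∈ Metric.ball (0 : ℂ) a, ‖deriv k w‖ ≤ B / b := by
    intro k a b c B hb0 habc hk hB w hw
    have hs := hsub hw habc
    refine Complex.norm_deriv_le_of_forall_mem_sphere_norm_le hb0 ?_
      fun y hy => hB y (hs (Metric.sphere_subset_closedBall hy))
    exact (hk.mono hs).diffContOnCl_ball subset_rfl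
  have hd1 : ∀ w ∈ Metric.ball (0 : ℂ) (R / 2), ‖deriv g w‖ ≤ M / (R / 4) :=
    cauchy (by positivity) (by linarith : R / 2 + R / 4 ≤ R) hd hb
  have hdd : DifferentiableOn ℂ (deriv g) (Metric.ball 0 (R / 2)) :=
    (hd.deriv Metric.isOpen_ball).mono (Metric.ball_subset_ball (by linarith))
  have hd2 : ∀ w ∈ Metric.ball (0 : ℂ) (R / 4), ‖deriv (deriv g) w‖ ≤ M / (R / 4) / (R / 8) :=
    cauchy (by positivity) (by linarith : R / 4 + R / 8 ≤ R / 2) hdd hd1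
  set L := M / (R / 4) / (R / 8) with hL
  have hL0 : 0 ≤ L := by positivity
  have hlip : ∀ w ∈ Metric.ball (0 : ℂ) (R / 4), ‖deriv g w - deriv g z‖ ≤ L * ‖w - z‖ := by
    intro w hw
    refine Convex.norm_image_sub_le_of_norm_deriv_le (s := Metric.ball (0 : ℂ) (R / 4))
      (fun x hx => ?_) hd2 (convex_ball _ _) hz hw
    exact hdd.differentiableAt
      (Metric.isOpen_ball.mem_nhds (Metric.ball_subset_ball (by linarith) hx))
  have hgd : ∀ x ∈ Metric.ball (0 : ℂ) (R / 4), HasDerivAt g (deriv g x) x := fun x hx =>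
    (hd.differentiableAt
      (Metric.isOpen_ball.mem_nhds (Metric.ball_subset_ball (by linarith) hx))).hasDerivAt
  have := Convex.norm_image_sub_le_of_norm_hasDerivWithin_le
    (s := Metric.ball (0 : ℂ) (R / 4) ∩ Metric.closedBall z ‖p - z‖)
    (f := fun x => g x - deriv g z * x) (f' := fun x => deriv g x - deriv g z) (x := z) (y := p)
    (C := L * ‖p - z‖)
    (fun x hx => by
      have := (hgd x hx.1).fun_sub ((hasDerivAt_id x).const_mul (deriv g z))
      simpa using this.hasDerivWithinAt)
    (fun x hx => (hlip x hx.1).trans (by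
      have := mem_closedBall_iff_norm.1 hx.2
      gcongr))
    ((convex_ball _ _).inter (convex_closedBall _ _))
    ⟨hz, Metric.mem_closedBall_self (norm_nonneg _)⟩
    ⟨hp, mem_closedBall_iff_norm.2 le_rfl⟩
  calc _ = ‖g p - deriv g z * p - (g z - deriv g z * z)‖ := by congr 1; ring
    _ ≤ _ := this
    _ = _ := by ring

/-! ### Linearizability from an invariant neighbourhood -/

/-- A germ whose iterates are all defined and bounded on a disk is linearizable: a limit of the
averages `(1 / n) ∑ λ⁻ʲ Fʲ` conjugates it to its linear part. The limit is taken along an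
ultrafilter, and the uniform Taylor estimate makes it holomorphic. -/
lemma isLinearizableGerm_of_mem_interior {f F : ℂ → ℂ} {K U : Set ℂ} {l : ℂ}
    (hf0 : f 0 = 0) (hl : deriv f 0 = l) (hl1 : ‖l‖ = 1) (hFf : F =ᶠ[𝓝 0] f)
    (hK : IsCompact K) (hU : IsOpen U) (hKU : K ⊆ U) (hF : DifferentiableOn ℂ F U)
    (hFK : MapsTo F K K) (h0 : K ∈ 𝓝 (0 : ℂ)) : IsLinearizableGerm f := by
  have hlne : l ≠ 0 := by rw [← norm_pos_iff, hl1]; exact one_pos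
  have hF0 : F 0 = 0 := by rw [hFf.eq_of_nhds, hf0]
  have hFd : deriv F 0 = l := by rw [hFf.deriv_eq, hl]
  obtain ⟨R, hR, hRK⟩ := Metric.mem_nhds_iff.1 h0
  obtain ⟨M, hM⟩ := hK.isBounded.exists_norm_le
  have hitK : ∀ n : ℕ, MapsTo F^[n] K K := fun n => hFK.iterate n
  have hit0 : ∀ n : ℕ, F^[n] 0 = 0 := fun n => Function.iterate_fixed hF0 n
  have hitd : ∀ n : ℕ, DifferentiableOn ℂ F^[n] (Metric.ball 0 R) := by
    intro n
    induction n with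
    | zero => exact differentiableOn_id
    | succ n ih =>
      rw [Function.iterate_succ']
      exact hF.comp ih fun z hz => hKU (hitK n (hRK hz))
  have hF' : HasDerivAt F l 0 := by
    rw [← hFd]
    exact (hF.differentiableAt (hU.mem_nhds (hKU (mem_of_mem_nhds h0)))).hasDerivAt
  have hitl : ∀ n : ℕ, HasDerivAt F^[n] (l ^ n) 0 := by
    intro n
    exact hF'.iterate (x := 0) hF0 n
  let H : ℕ → ℂ → ℂ := fun n z => (n + 1 : ℂ)⁻¹ * ∑ j ∈ Finset.range (n + 1), (l ^ j)⁻¹ * F^[j] z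
  have hn1 : ∀ n : ℕ, (n + 1 : ℂ) ≠ 0 := fun n => by exact_mod_cast n.succ_ne_zero
  have hHd : ∀ n, DifferentiableOn ℂ (H n) (Metric.ball 0 R) := fun n =>
    (DifferentiableOn.fun_sum fun j _ => (hitd j).const_mul _).const_mul _
  have hHM : ∀ n, ∀ z ∈ K, ‖H n z‖ ≤ M := by
    intro n z hz
    have e : ‖∑ j ∈ Finset.range (n + 1), (l ^ j)⁻¹ * F^[j] z‖ ≤ (n + 1 : ℝ) * M := by
      refine (norm_sum_le _ _).trans ((Finset.sum_le_card_nsmul _ _ M fun j _ => ?_).trans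
        (by simp [add_mul]))
      rw [norm_mul, norm_inv, norm_pow, hl1, one_pow, inv_one, one_mul]
      exact hM _ (hitK j hz)
    have e2 : ‖(n + 1 : ℂ)⁻¹‖ = (n + 1 : ℝ)⁻¹ := by
      rw [norm_inv]; congr 1; exact_mod_cast Complex.norm_natCast (n + 1)
    simp only [H, norm_mul, e2]
    rw [inv_mul_le_iff₀ (by positivity)]
    exact e
  have hH1 : ∀ n, deriv (H n) 0 = 1 := by
    intro n
    have e : HasDerivAt (H n)
        ((n + 1 : ℂ)⁻¹ * ∑ j ∈ Finset.range (n + 1), (l ^ j)⁻¹ * l ^ j) 0 :=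
      (HasDerivAt.fun_sum fun j _ => (hitl j).const_mul _).const_mul _
    rw [e.deriv]
    simp [hlne, hn1]
  -- The averages almost conjugate `F` to its linear part.
  have hHF : ∀ n, ∀ z, H n (F z) - l * H n z
      = (n + 1 : ℂ)⁻¹ * (l * ((l ^ (n + 1))⁻¹ * F^[n + 1] z - z)) := by
    intro n z
    have e : ∑ j ∈ Finset.range (n + 1), (l ^ j)⁻¹ * F^[j] (F z)
        - l * ∑ j ∈ Finset.range (n + 1), (l ^ j)⁻¹ * F^[j] z
        = l * ((l ^ (n + 1))⁻¹ * F^[n + 1] z - z) := by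
      have := Finset.sum_range_sub (fun j => (l ^ j)⁻¹ * F^[j] z) (n + 1)
      simp only [pow_zero, inv_one, one_mul, Function.iterate_zero, id] at this
      rw [← this, Finset.mul_sum, Finset.mul_sum, ← Finset.sum_sub_distrib]
      refine Finset.sum_congr rfl fun j _ => ?_
      rw [← Function.iterate_succ_apply, pow_succ]
      field_simp
    rw [← e]; simp only [H]; ring
  let 𝓤 : Filter ℕ := (hyperfilter ℕ : Filter ℕ)
  have h𝓤 : 𝓤 ≤ atTop := Nat.hyperfilter_le_atTop
  have hlim : ∀ (a : ℕ → ℂ) (B : ℝ), (∀ n, ‖a n‖ ≤ B) → ∃ b, Tendsto a 𝓤 (𝓝 b) := by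
    intro a B ha
    obtain ⟨b, -, hb⟩ := (isCompact_closedBall (0 : ℂ) B).ultrafilter_le_nhds'
      ((hyperfilter ℕ).map a) (by
        rw [Ultrafilter.mem_map]
        exact Filter.univ_mem' fun n => by simpa using ha n)
    exact ⟨b, hb⟩
  have hlimK : ∀ z, ∃ b, z ∈ K → Tendsto (fun n => H n z) 𝓤 (𝓝 b) := by
    intro z
    by_cases hz : z ∈ K
    · obtain ⟨b, hb⟩ := hlim (fun n => H n z) M fun n => hHM n z hz
      exact ⟨b, fun _ => hb⟩
    · exact ⟨0, fun h => absurd h hz⟩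
  choose h hh using hlimK
  have hb4 : Metric.ball (0 : ℂ) (R / 4) ⊆ Metric.ball 0 R :=
    Metric.ball_subset_ball (by linarith)
  have hquad : ∀ z ∈ Metric.ball (0 : ℂ) (R / 4), ∀ d, Tendsto (fun n => deriv (H n) z) 𝓤 (𝓝 d) →
      HasDerivAt h d z := by
    intro z hz d hd
    have e : ∀ p ∈ Metric.ball (0 : ℂ) (R / 4),
        ‖h p - h z - d * (p - z)‖ ≤ M / (R / 4) / (R / 8) * ‖p - z‖ ^ 2 := by
      intro p hp
      refine le_of_tendsto ((((hh p (hRK (hb4 hp))).sub (hh z (hRK (hb4 hz)))).sub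
        (hd.mul_const _)).norm) (Eventually.of_forall fun n => ?_)
      exact norm_sub_sub_deriv_mul_le hR (hHd n) (fun w hw => hHM n w (hRK hw)) hz hp
    rw [hasDerivAt_iff_isLittleO]
    have o : (fun p => ‖p - z‖ ^ 2) =o[𝓝 z] fun p => p - z := by
      have := (Asymptotics.isLittleO_pow_id (𝕜 := ℂ) (n := 2) one_lt_two).norm_left
      have t : Tendsto (fun p : ℂ => p - z) (𝓝 z) (𝓝 0) := by
        simpa using (continuous_sub_right z).tendsto z
      simpa [Function.comp_def] using this.comp_tendsto t
    refine Asymptotics.IsBigO.trans_isLittleO ?_ o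
    refine Asymptotics.IsBigO.of_bound (M / (R / 4) / (R / 8)) ?_
    filter_upwards [Metric.isOpen_ball.mem_nhds hz] with p hp
    have := e p hp
    simpa [mul_comm] using this
  have hhd : ∀ z ∈ Metric.ball (0 : ℂ) (R / 4), DifferentiableAt ℂ h z := by
    intro z hz
    obtain ⟨d, hd⟩ := hlim (fun n => deriv (H n) z) (M / (R / 4)) fun n => by
      have hs : Metric.closedBall z (R / 4) ⊆ Metric.ball 0 R := by
        intro y hy
        rw [mem_ball_zero_iff] at hz ⊢
        rw [mem_closedBall_iff_norm] at hy
        have := norm_le_insert' y z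
        linarith
      exact Complex.norm_deriv_le_of_forall_mem_sphere_norm_le (by positivity)
        ((hHd n).mono hs |>.diffContOnCl_ball subset_rfl)
        fun y hy => hHM n y (hRK (hs (Metric.sphere_subset_closedBall hy)))
    exact (hquad z hz d hd).differentiableAt
  have hb0 : Metric.ball (0 : ℂ) (R / 4) ∈ 𝓝 (0 : ℂ) := Metric.ball_mem_nhds 0 (by positivity)
  have hhan : AnalyticAt ℂ h 0 :=
    (DifferentiableOn.analyticAt (fun z hz => (hhd z hz).differentiableWithinAt) hb0)
  have hh1 : deriv h 0 = 1 := (hquad 0 (mem_of_mem_nhds hb0) 1 (by simp [hH1])).deriv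
  have hh0 : h 0 = 0 := by
    refine tendsto_nhds_unique (hh 0 (mem_of_mem_nhds h0)) ?_
    simp [H, hit0]
  have hhF : ∀ z ∈ K, h (F z) = l * h z := by
    intro z hz
    have t1 := (hh _ (hFK hz)).sub ((hh z hz).const_mul l)
    have t2 : Tendsto (fun n => H n (F z) - l * H n z) 𝓤 (𝓝 0) := by
      refine Tendsto.mono_left ?_ h𝓤
      have hB : ∀ n : ℕ, ‖H n (F z) - l * H n z‖ ≤ (M + M) * (1 / ((n : ℝ) + 1)) := by
        intro n
        rw [hHF, norm_mul, norm_mul, hl1, one_mul, norm_inv]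
        have e2 : ‖(n + 1 : ℂ)‖ = (n + 1 : ℝ) := by exact_mod_cast Complex.norm_natCast (n + 1)
        rw [e2, mul_comm, one_div]
        gcongr
        refine (norm_sub_le _ _).trans (add_le_add ?_ (hM z hz))
        rw [norm_mul, norm_inv, norm_pow, hl1, one_pow, inv_one, one_mul]
        exact hM _ (hitK _ hz)
      refine squeeze_zero_norm hB ?_
      simpa using tendsto_one_div_add_atTop_nhds_zero_nat.const_mul (M + M)
    exact sub_eq_zero.1 (tendsto_nhds_unique t1 t2)
  obtain ⟨g, hg, hg0, hg1, hgh, hhg⟩ := hhan.exists_local_inverse hh0 (by rw [hh1]; exact one_ne_zero)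
  refine ⟨g, hg, hg0, by rw [hg1, hh1, inv_one], ?_⟩
  have tg : Tendsto g (𝓝 0) (𝓝 0) := by simpa [hg0] using hg.continuousAt.tendsto
  have tf : Tendsto f (𝓝 0) (𝓝 0) := by
    have := hF'.continuousAt.tendsto.congr' hFf
    rwa [hF0] at this
  filter_upwards [hhg, tg.eventually (tf.eventually hgh), tg.eventually hFf, tg.eventually h0]
    with w e1 e2 e3 e4
  rw [← e2, ← e3, hhF _ e4, e1, hl]

/-! ### Normal forms of finite order -/

/-- Absent resonances, a germ is conjugate to its linear part to any finite order. The change of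
variables is entire, hence continuous on all of a given continuum. -/
lemma exists_normal_form {f : ℂ → ℂ} {l : ℂ} (hf : AnalyticAt ℂ f 0) (hf0 : f 0 = 0)
    (hl : deriv f 0 = l) (hres : ∀ k, 2 ≤ k → l ^ k ≠ l) (N : ℕ) :
    ∃ h : ℂ → ℂ, Differentiable ℂ h ∧ h 0 = 0 ∧ deriv h 0 = 1 ∧
      ∃ g : ℂ → ℂ, AnalyticAt ℂ g 0 ∧ ∀ z, h (f z) - l * h z = z ^ (N + 2) * g z := by
  obtain ⟨f₁, hf₁, hf₁0, hff₁⟩ := hf.exists_eq_add_mul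
  simp only [hf0, zero_add] at hff₁
  rw [hl] at hf₁0
  induction N with
  | zero =>
    obtain ⟨f₂, hf₂, -, hff₂⟩ := hf₁.exists_eq_add_mul
    refine ⟨id, differentiable_id, rfl, deriv_id 0, f₂, hf₂, fun z => ?_⟩
    simp only [id]
    rw [hff₁, hff₂, hf₁0]
    ring
  | succ N ih =>
    obtain ⟨h, hh, hh0, hh1, g, hg, hgh⟩ := ih
    obtain ⟨g₁, hg₁, -, hgg₁⟩ := hg.exists_eq_add_mul
    obtain ⟨k, hk, -, hfk⟩ := (hf₁.pow (N + 2)).exists_eq_add_mul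
    have hne : l ^ (N + 2) - l ≠ 0 := sub_ne_zero.2 (hres _ (by omega))
    -- The coefficient that cancels the leading term of the error.
    set d := -(g 0) / (l ^ (N + 2) - l) with hd
    have hd' : g 0 + d * (l ^ (N + 2) - l) = 0 := by rw [hd]; field_simp; ring
    have hder : HasDerivAt (fun z => h z + d * z ^ (N + 2)) 1 0 := by
      have e := (hh 0).hasDerivAt.fun_add ((hasDerivAt_pow (N + 2) (0 : ℂ)).const_mul d)
      rw [hh1] at e
      simpa using e
    refine ⟨fun z => h z + d * z ^ (N + 2), hh.add ((differentiable_id.pow _).const_mul d), ?_,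
      hder.deriv, fun z => g₁ z + d * k z, hg₁.add (analyticAt_const.mul hk), fun z => ?_⟩
    · simp [hh0]
    · have e1 := hgh z
      have e2 := hfk z
      simp only [Pi.pow_apply, hf₁0] at e2
      have e3 : f z ^ (N + 2) = z ^ (N + 2) * (l ^ (N + 2) + z * k z) := by
        rw [← e2, hff₁, mul_pow]
      simp only
      rw [e3]
      linear_combination e1 + z ^ (N + 2) * hgg₁ z + z ^ (N + 2) * hd'

/-! ### Density of the continuum at good scales -/

/-- A connected set through `0` that is invariant under an irrationally indifferent germ is, at
arbitrarily small scales `r`, within `η r ^ M` of every point of the annulus `r / 2 ≤ |z| ≤ r`.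
The scales are `r = q ^ (-1 / M)`, where `q` is such that `q` iterates of the rotation are
`4π / q`-dense; a normal form of order `2 * M + 2` keeps the error of these `q` iterates
negligible, and connectedness provides a point of the set on each small circle. -/
lemma exists_scale_dense {f : ℂ → ℂ} {K : Set ℂ} {α : ℝ} (hα : Irrational α)
    (hf : AnalyticAt ℂ f 0) (hf0 : f 0 = 0)
    (hl : deriv f 0 = Complex.exp (2 * Real.pi * Complex.I * α))
    (hK : IsConnected K) (h0K : (0 : ℂ) ∈ K) (hK1 : ∃ z ∈ K, z ≠ 0)
    (hfK : ∀ᶠ z in 𝓝 0, z ∈ K → f z ∈ K) (M : ℕ) (hM : 1 ≤ M) {η ε : ℝ} (hη : 0 < η)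
    (hε : 0 < ε) :
    ∃ r, 0 < r ∧ r < ε ∧ ∀ z : ℂ, r / 2 ≤ ‖z‖ → ‖z‖ ≤ r → ∃ p ∈ K, ‖p - z‖ ≤ η * ‖z‖ ^ M := by
  set l := Complex.exp (2 * Real.pi * Complex.I * α) with hldef
  have hl1 : ‖l‖ = 1 := norm_exp_two_pi_I_mul α
  obtain ⟨h, hh, hh0, hh1, g, hg, hgh⟩ :=
    exists_normal_form hf hf0 hl hα.exp_pow_ne_self (2 * M)
  obtain ⟨z₁, hz₁K, hz₁⟩ := hK1
  have hz₁' : 0 < ‖z₁‖ := norm_pos_iff.2 hz₁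
  -- Local bounds near `0`.
  obtain ⟨C, hC0, hC⟩ : ∃ C, 0 < C ∧ ∀ᶠ z in 𝓝 (0 : ℂ), ‖g z‖ ≤ C := by
    refine ⟨‖g 0‖ + 1, by positivity, ?_⟩
    exact (hg.continuousAt.norm.eventually_lt_const (lt_add_one _)).mono fun _ => le_of_lt
  have hiso : ∀ᶠ x : ℂ × ℂ in 𝓝 (0, 0), ‖h x.1 - h x.2 - (x.1 - x.2)‖ ≤ 1 / 2 * ‖x.1 - x.2‖ := by
    have e := (hh.analyticAt 0).hasStrictDerivAt
    rw [hh1] at e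
    have e2 := e.hasStrictFDerivAt.isLittleO.bound (by norm_num : (0 : ℝ) < 1 / 2)
    simpa using e2
  have hf2 : ∀ᶠ z in 𝓝 (0 : ℂ), ‖f z‖ ≤ 2 * ‖z‖ := by
    obtain ⟨f₁, hf₁, hf₁0, hff₁⟩ := hf.exists_eq_add_mul
    have e : ‖f₁ 0‖ < 2 := by rw [hf₁0, hl, hl1]; norm_num
    filter_upwards [hf₁.continuousAt.norm.eventually_lt_const e] with z hz
    rw [hff₁, hf0, zero_add, norm_mul, mul_comm]
    gcongr
  obtain ⟨ρ, hρ, hloc⟩ := Metric.eventually_nhds_iff.1 (hC.and (hf2.and hfK))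
  obtain ⟨ρ', hρ', hiso'⟩ := Metric.eventually_nhds_iff.1 hiso
  simp only [dist_zero_right] at hloc
  have hiso2 : ∀ x y : ℂ, ‖x‖ < ρ' → ‖y‖ < ρ' →
      ‖x - y‖ ≤ 2 * ‖h x - h y‖ ∧ ‖h x - h y‖ ≤ 2 * ‖x - y‖ := by
    intro x y hx hy
    have e := @hiso' (x, y) (by simpa [Prod.dist_eq] using ⟨hx, hy⟩)
    simp only at e
    have e1 := norm_sub_norm_le (x - y) (h x - h y)
    have e2 := norm_sub_norm_le (h x - h y) (x - y)
    rw [norm_sub_rev (x - y)] at e1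
    constructor <;> linarith [norm_nonneg (x - y)]
  have hiso0 : ∀ x : ℂ, ‖x‖ < ρ' → ‖x‖ ≤ 2 * ‖h x‖ ∧ ‖h x‖ ≤ 2 * ‖x‖ := by
    intro x hx
    simpa [hh0] using hiso2 x 0 hx (by simpa using hρ')
  -- Choice of the scale.
  set D := C * 8 ^ (2 * M + 2) with hDdef
  have hD0 : 0 < D := by positivity
  have hpi := Real.pi_pos
  obtain ⟨r, q, hr, hqr, hrρ, hrρ', hr1, hrε, hrz, hrD, hrη, hq0, hq⟩ : ∃ (r : ℝ) (q : ℕ), 0 < r ∧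
      (q : ℝ) * r ^ M = 1 ∧ 16 * r < ρ ∧ 16 * r < ρ' ∧ r < 1 ∧ r < ε ∧ 4 * r < ‖z₁‖ ∧
      D * r < 1 / 4 ∧ 2 * (D + 8 * Real.pi) * r * 2 ^ M < η ∧ 0 < q ∧
      ∀ v : ℂ, ‖v‖ = 1 → ∃ j < q, ‖l ^ j - v‖ ≤ 4 * Real.pi / q := by
    have ev : ∀ᶠ r : ℝ in 𝓝[>] 0, 16 * r < ρ ∧ 16 * r < ρ' ∧ r < 1 ∧ r < ε ∧ 4 * r < ‖z₁‖ ∧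
      D * r < 1 / 4 ∧ 2 * (D + 8 * Real.pi) * r * 2 ^ M < η := by
      refine eventually_nhdsWithin_of_eventually_nhds ?_
      have tt : ∀ (φ : ℝ → ℝ) (b : ℝ), Continuous φ → φ 0 < b → ∀ᶠ r in 𝓝 0, φ r < b :=
        fun φ b hφ hb => (hφ.tendsto 0).eventually_lt_const hb
      refine (tt (fun r => 16 * r) _ (by fun_prop) (by simpa)).and
        ((tt (fun r => 16 * r) _ (by fun_prop) (by simpa)).and
        ((tt (fun r => r) _ (by fun_prop) (by simp)).and
        ((tt (fun r => r) _ (by fun_prop) (by simpa)).and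
        ((tt (fun r => 4 * r) _ (by fun_prop) (by simpa)).and
        ((tt (fun r => D * r) _ (by fun_prop) (by simp)).and
        (tt (fun r => 2 * (D + 8 * Real.pi) * r * 2 ^ M) _ (by fun_prop) (by simpa)))))))
    obtain ⟨δ, hδ, hδ'⟩ := mem_nhdsGT_iff_exists_Ioo_subset.1 ev
    have hδ : 0 < δ := hδ
    obtain ⟨q, hNq, hq0, hq⟩ := hα.exists_dense_powers (⌈(δ ^ M)⁻¹⌉₊ + 1)
    have hq0' : (0 : ℝ) < q := by exact_mod_cast hq0
    have hM0 : M ≠ 0 := by omega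
    set r : ℝ := ((q : ℝ)⁻¹) ^ ((M : ℝ)⁻¹) with hrdef
    have hr : 0 < r := Real.rpow_pos_of_pos (by positivity) _
    have hrM : r ^ M = (q : ℝ)⁻¹ := Real.rpow_inv_natCast_pow (by positivity) hM0
    have hrδ : r < δ := by
      refine lt_of_pow_lt_pow_left₀ M hδ.le ?_
      rw [hrM]
      refine inv_lt_of_inv_lt₀ (by positivity) ?_
      calc _ ≤ (⌈(δ ^ M)⁻¹⌉₊ : ℝ) := Nat.le_ceil _
        _ < q := by exact_mod_cast hNq
    obtain ⟨a1, a2, a3, a4, a5, a6, a7⟩ := hδ' ⟨hr, hrδ⟩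
    exact ⟨r, q, hr, by rw [hrM]; field_simp, a1, a2, a3, a4, a5, a6, a7, hq0, hq⟩
  have hq0' : (0 : ℝ) < q := by exact_mod_cast hq0
  refine ⟨r, hr, hrε, fun z hz1 hz2 => ?_⟩
  obtain ⟨hzh1, hzh2⟩ := hiso0 z (by linarith)
  set s := ‖h z‖ with hs
  -- A point of the continuum on the circle through `z`, in the normal form coordinate.
  obtain ⟨p, hpK, hps, hp4⟩ : ∃ p ∈ K, ‖h p‖ = s ∧ ‖p‖ ≤ 4 * r := by
    have hcont : ContinuousOn (fun p : ℂ => max ‖h p‖ (‖p‖ / 2)) K :=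
      (hh.continuous.norm.max (continuous_norm.div_const 2)).continuousOn
    have := hK.isPreconnected.intermediate_value h0K hz₁K hcont
    obtain ⟨p, hpK, hp⟩ := this (show s ∈ _ from ⟨by simp [hh0, hs],
      le_max_of_le_right (by linarith)⟩)
    have hp : max ‖h p‖ (‖p‖ / 2) = s := hp
    have hp4 : ‖p‖ ≤ 4 * r := by
      have := le_max_right ‖h p‖ (‖p‖ / 2)
      linarith
    refine ⟨p, hpK, ?_, hp4⟩
    have := (hiso0 p (by linarith)).1
    rwa [max_eq_left (by linarith)] at hp
  have hs0 : 0 < s := by linarith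
  have hhp : h p ≠ 0 := by rw [← norm_pos_iff, hps]; exact hs0
  obtain ⟨j, hjq, hj⟩ := hq (h z / h p) (by rw [norm_div, hps, div_self hs0.ne'])
  have hj' : ‖l ^ j * h p - h z‖ ≤ 8 * Real.pi * r ^ (M + 1) := by
    have e : l ^ j * h p - h z = (l ^ j - h z / h p) * h p := by field_simp
    rw [e, norm_mul, hps]
    have e2 : (q : ℝ)⁻¹ = r ^ M := inv_eq_of_mul_eq_one_right hqr
    calc _ ≤ 4 * Real.pi / q * (2 * r) := by gcongr; linarith
      _ = 4 * Real.pi * r ^ M * (2 * r) := by rw [← e2]; ring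
      _ = _ := by ring
  -- One step of the dynamics costs `E`, and `q` steps cost at most `D * r ^ (M + 1)`.
  set E := C * (8 * r) ^ (2 * M + 2) with hE
  have hE0 : 0 ≤ E := by positivity
  have hqE : q * E ≤ D * r ^ (M + 1) := by
    calc q * E = D * (q * r ^ M) * r ^ (M + 1) * r := by rw [hE, hDdef]; ring
      _ ≤ D * (q * r ^ M) * r ^ (M + 1) * 1 := by gcongr
      _ = _ := by rw [hqr]; ring
  have hDr : D * r ^ (M + 1) ≤ s := by
    have : r ^ M ≤ 1 := pow_le_one₀ hr.le hr1.le
    calc D * r ^ (M + 1) = D * r * r ^ M := by ring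
      _ ≤ 1 / 4 * r ^ M := by gcongr
      _ = 1 / 4 * r ^ (M - 1) * r := by
        rw [mul_assoc, ← pow_succ, Nat.sub_add_cancel hM]
      _ ≤ 1 / 4 * 1 * r := by
        have : r ^ (M - 1) ≤ 1 := pow_le_one₀ hr.le hr1.le
        gcongr
      _ ≤ s := by linarith
  have horb : ∀ i : ℕ, i ≤ q → f^[i] p ∈ K ∧ ‖f^[i] p‖ ≤ 8 * r ∧
      ‖h (f^[i] p) - l ^ i * h p‖ ≤ i * E := by
    intro i
    induction i with
    | zero => intro _; exact ⟨hpK, by simp only [Function.iterate_zero, id]; linarith, by simp⟩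
    | succ i ih =>
      intro hi
      obtain ⟨h1, h2, h3⟩ := ih (by omega)
      obtain ⟨hg1, hf1, hk1⟩ := @hloc (f^[i] p) (by linarith)
      rw [Function.iterate_succ_apply']
      have h4 : ‖h (f (f^[i] p)) - l ^ (i + 1) * h p‖ ≤ ((i + 1 : ℕ) : ℝ) * E := by
        have e : h (f (f^[i] p)) - l ^ (i + 1) * h p
            = (f^[i] p) ^ (2 * M + 2) * g (f^[i] p) + l * (h (f^[i] p) - l ^ i * h p) := by
          rw [← hgh]; ring
        rw [e]
        refine (norm_add_le _ _).trans ?_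
        rw [norm_mul, norm_mul, norm_pow, hl1, one_mul]
        have e2 : ‖f^[i] p‖ ^ (2 * M + 2) * ‖g (f^[i] p)‖ ≤ E := by
          rw [hE, mul_comm]; gcongr
        push_cast
        linarith
      refine ⟨hk1 h1, ?_, h4⟩
      have h5 : ‖h (f (f^[i] p))‖ ≤ 2 * s := by
        have e := norm_le_insert' (h (f (f^[i] p))) (l ^ (i + 1) * h p)
        rw [norm_mul, norm_pow, hl1, one_pow, one_mul, hps] at e
        have e2 : ((i + 1 : ℕ) : ℝ) * E ≤ q * E := by
          have : ((i + 1 : ℕ) : ℝ) ≤ q := by exact_mod_cast hi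
          gcongr
        linarith
      have := (hiso0 (f (f^[i] p)) (by linarith)).1
      linarith
  obtain ⟨h1, h2, h3⟩ := horb j hjq.le
  refine ⟨f^[j] p, h1, ?_⟩
  have e1 := (hiso2 (f^[j] p) z (by linarith) (by linarith)).1
  have e2 : (j : ℝ) * E ≤ q * E := by
    have : (j : ℝ) ≤ q := by exact_mod_cast hjq.le
    gcongr
  have e3 := norm_sub_le_norm_sub_add_norm_sub (h (f^[j] p)) (l ^ j * h p) (h z)
  calc ‖f^[j] p - z‖ ≤ 2 * (D * r ^ (M + 1) + 8 * Real.pi * r ^ (M + 1)) := by linarith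
    _ = (2 * (D + 8 * Real.pi) * r * 2 ^ M) * (r / 2) ^ M := by rw [div_pow]; field_simp; ring
    _ ≤ η * ‖z‖ ^ M := by gcongr

/-! ### Repelling petals of a germ tangent to the identity -/

/-- The sector `Re (a zᵐ) ≥ |a zᵐ| / 2` around the repelling directions of `z + a zᵐ⁺¹ + ⋯`. -/
def InRepellingSector (a : ℂ) (m : ℕ) (z : ℂ) : Prop :=
  ‖a * z ^ m‖ / 2 ≤ (a * z ^ m).re

lemma half_norm_le_re_inv_iff {u : ℂ} (hu : u ≠ 0) :
    ‖u⁻¹‖ / 2 ≤ (u⁻¹).re ↔ ‖u‖ / 2 ≤ u.re := by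
  have h : 0 < ‖u‖ := norm_pos_iff.2 hu
  rw [Complex.inv_re, norm_inv, Complex.normSq_eq_norm_sq, le_div_iff₀ (by positivity)]
  rw [show ‖u‖⁻¹ / 2 * ‖u‖ ^ 2 = ‖u‖ / 2 by field_simp]

/-- The inverse branch of a germ tangent to the identity preserves the repelling sector near `0`,
and moves points towards `0` at a definite but slow rate. Sector invariance is seen in the
coordinate `W = 1 / (a zᵐ)`, where the inverse branch is asymptotic to `W ↦ W + m`. -/
lemma eventually_repellingSector_inverse {T S A : ℂ → ℂ} {m : ℕ} (hm : 1 ≤ m)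
    (hA : AnalyticAt ℂ A 0) (ha : A 0 ≠ 0) (hTA : ∀ᶠ z in 𝓝 0, T z = z + z ^ (m + 1) * A z)
    (hS : AnalyticAt ℂ S 0) (hS0 : S 0 = 0) (hS1 : deriv S 0 = 1)
    (hTS : ∀ᶠ z in 𝓝 0, T (S z) = z) :
    ∃ c : ℝ, 0 < c ∧ ∀ᶠ z in 𝓝 (0 : ℂ), z ≠ 0 → InRepellingSector (A 0) m z →
      InRepellingSector (A 0) m (S z) ∧ ‖S z‖ ≤ ‖z‖ - c * ‖z‖ ^ (m + 1) ∧ ‖z‖ / 2 ≤ ‖S z‖ := by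
  set a := A 0 with hadef
  have hapos : 0 < ‖a‖ := norm_pos_iff.2 ha
  obtain ⟨σ, hσ, hσ0, hSσ⟩ := hS.exists_eq_add_mul
  rw [hS1] at hσ0
  simp only [hS0, zero_add] at hSσ
  have hm0 : m ≠ 0 := by omega
  have tS : Tendsto S (𝓝 0) (𝓝 0) := by simpa [hS0] using hS.continuousAt.tendsto
  -- `S z = z (1 - v z)` with `v z = a zᵐ κ z` and `κ z → 1`.
  let κ : ℂ → ℂ := fun z => σ z ^ (m + 1) * A (S z) / a
  have hκ : AnalyticAt ℂ κ 0 :=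
    ((hσ.pow _).mul (AnalyticAt.comp (by rw [hS0]; exact hA) hS)).div_const
  have hκ0 : κ 0 = 1 := by simp only [κ, hσ0, hS0, one_pow, one_mul]; exact div_self ha
  let v : ℂ → ℂ := fun z => a * z ^ m * κ z
  have hv : AnalyticAt ℂ v 0 := (analyticAt_const.mul (analyticAt_id.pow m)).mul hκ
  have hv0 : v 0 = 0 := by simp [v, hm0]
  have hσv : ∀ᶠ z in 𝓝 (0 : ℂ), z ≠ 0 → σ z = 1 - v z := by
    filter_upwards [hTS, tS.eventually hTA] with z h1 h2 hz
    rw [h1, hSσ] at h2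
    have e : v z = z ^ m * (σ z ^ (m + 1) * A (S z)) := by
      simp only [v, κ]; field_simp
    apply mul_left_cancel₀ hz
    rw [e, hSσ]
    linear_combination -h2
  have hψ : AnalyticAt ℂ (fun y : ℂ => ((1 - y) ^ m)⁻¹) 0 :=
    ((analyticAt_const.sub analyticAt_id).pow m).inv (by simp)
  obtain ⟨ψ, hψa, hψ0, hψe⟩ := hψ.exists_eq_add_mul
  have hψm : ψ 0 = m := by
    rw [hψ0]
    have e : HasDerivAt (fun y : ℂ => ((1 - y) ^ m)⁻¹) m 0 := by
      have := ((((hasDerivAt_id (0 : ℂ)).const_sub 1).fun_pow m).fun_inv (by simp))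
      simpa using this
    exact e.deriv
  have c1 : ∀ᶠ z in 𝓝 (0 : ℂ), ‖κ z - 1‖ < 1 / 4 := by
    have : Tendsto (fun z => ‖κ z - 1‖) (𝓝 0) (𝓝 0) := by
      simpa [hκ0] using (hκ.continuousAt.sub (continuousAt_const (y := (1 : ℂ)))).norm.tendsto
    exact this.eventually_lt_const (by norm_num)
  have c2 : ∀ᶠ z in 𝓝 (0 : ℂ), ‖a * z ^ m‖ < 1 / 16 := by
    have : Tendsto (fun z : ℂ => ‖a * z ^ m‖) (𝓝 0) (𝓝 0) := by
      have e : Continuous fun z : ℂ => ‖a * z ^ m‖ := by fun_prop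
      simpa [hm0] using e.tendsto 0
    exact this.eventually_lt_const (by norm_num)
  have c3 : ∀ᶠ z in 𝓝 (0 : ℂ), ‖κ z * ψ (v z) - m‖ < m / 4 := by
    have e1 : ContinuousAt (fun z => ψ (v z)) 0 :=
      ContinuousAt.comp (by rw [hv0]; exact hψa.continuousAt) hv.continuousAt
    have : Tendsto (fun z => ‖κ z * ψ (v z) - m‖) (𝓝 0) (𝓝 0) := by
      simpa [hκ0, hv0, hψm] using
        ((hκ.continuousAt.mul e1).sub (continuousAt_const (y := (m : ℂ)))).norm.tendsto
    exact this.eventually_lt_const (by positivity)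
  refine ⟨‖a‖ / 8, by positivity, ?_⟩
  filter_upwards [hσv, c1, c2, c3] with z h0 h1 h2 h3 hz hsec
  specialize h0 hz
  have hzpos : 0 < ‖z‖ := norm_pos_iff.2 hz
  set u := a * z ^ m with hu
  have hu0 : u ≠ 0 := mul_ne_zero ha (pow_ne_zero _ hz)
  have hvu : v z = u * κ z := rfl
  have hsec' : ‖u‖ / 2 ≤ u.re := hsec
  have hun : ‖u‖ = ‖a‖ * ‖z‖ ^ m := by rw [hu, norm_mul, norm_pow]
  have hupos : 0 < ‖u‖ := norm_pos_iff.2 hu0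
  have hκn : ‖κ z‖ ≤ 2 := by
    have := norm_le_insert' (κ z) 1
    rw [norm_one] at this
    linarith
  have hvn : ‖v z‖ ≤ 2 * ‖u‖ := by
    rw [hvu, norm_mul, mul_comm]; gcongr
  have hvre : ‖u‖ / 4 ≤ (v z).re := by
    have e : v z = u + u * (κ z - 1) := by rw [hvu]; ring
    have e2 : |(u * (κ z - 1)).re| ≤ ‖u‖ * (1 / 4) := by
      refine (Complex.abs_re_le_norm _).trans ?_
      rw [norm_mul]; gcongr
    rw [e, Complex.add_re]
    linarith [(abs_le.1 e2).1]
  have hσ1 : ‖σ z‖ ≤ 1 - ‖u‖ / 8 := by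
    rw [h0]
    refine le_of_sq_le_sq ?_ (by linarith)
    have e : ‖1 - v z‖ ^ 2 = 1 - 2 * (v z).re + ‖v z‖ ^ 2 := by
      rw [← Complex.normSq_eq_norm_sq, ← Complex.normSq_eq_norm_sq, Complex.normSq_sub]
      simp
      ring
    rw [e]
    nlinarith [norm_nonneg (v z)]
  have hσ2 : 1 / 2 ≤ ‖σ z‖ := by
    rw [h0]
    have := norm_sub_norm_le 1 (v z)
    rw [norm_one] at this
    linarith
  have hσne : σ z ≠ 0 := by rw [← norm_pos_iff]; linarith
  have hSz : S z = z * σ z := hSσ z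
  refine ⟨?_, ?_, ?_⟩
  · have hu' : a * (S z) ^ m = u * σ z ^ m := by rw [hSz, hu]; ring
    have hu'0 : u * σ z ^ m ≠ 0 := mul_ne_zero hu0 (pow_ne_zero _ hσne)
    unfold InRepellingSector
    rw [hu', ← half_norm_le_re_inv_iff hu'0]
    rw [← half_norm_le_re_inv_iff hu0] at hsec'
    have eW : (u * σ z ^ m)⁻¹ = u⁻¹ + κ z * ψ (v z) := by
      have := hψe (v z)
      simp only [sub_zero, one_pow, inv_one] at this
      rw [mul_inv, h0, this, hvu]
      field_simp
    rw [eW]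
    set δ := κ z * ψ (v z) - m with hδ
    have eδ : κ z * ψ (v z) = m + δ := by rw [hδ]; ring
    have r1 := (abs_le.1 ((Complex.abs_re_le_norm δ).trans h3.le)).1
    have r2 : ‖u⁻¹ + (m + δ)‖ ≤ ‖u⁻¹‖ + (m + ‖δ‖) := by
      refine (norm_add_le _ _).trans ?_
      gcongr
      refine (norm_add_le _ _).trans ?_
      simp
    rw [eδ]
    simp only [Complex.add_re, Complex.natCast_re]
    have : (0 : ℝ) ≤ m := by positivity
    linarith
  · rw [hSz, norm_mul]
    calc ‖z‖ * ‖σ z‖ ≤ ‖z‖ * (1 - ‖u‖ / 8) := by gcongr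
      _ = _ := by rw [hun]; ring
  · rw [hSz, norm_mul]
    nlinarith

/-- Measured in units of `|z|ᵐ⁺¹`, which is the size of one step of `T`, the distance of a nearby
point `p` to `z` grows by at most a factor `1 + O(|z|ᵐ⁺¹)` under `T`. -/
lemma eventually_norm_sub_mul_le {T A : ℂ → ℂ} {m : ℕ} (hm : 1 ≤ m) (hT : AnalyticAt ℂ T 0)
    (hA : AnalyticAt ℂ A 0) (hTA : ∀ᶠ z in 𝓝 0, T z = z + z ^ (m + 1) * A z) :
    ∃ C : ℝ, 0 < C ∧ ∀ᶠ z in 𝓝 (0 : ℂ), ∀ p, ‖p - z‖ ≤ ‖z‖ ^ (m + 1) →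
      ‖T p - T z‖ * ‖z‖ ^ (m + 1) ≤ ‖p - z‖ * ‖T z‖ ^ (m + 1) * (1 + C * ‖z‖ ^ (m + 1)) := by
  have hm0 : m ≠ 0 := by omega
  -- Taylor bound for `T`.
  obtain ⟨L, hL0, R, hR, hL⟩ : ∃ L, 0 ≤ L ∧ ∃ R : ℝ, 0 < R ∧ ∀ z p : ℂ, ‖z‖ < R → ‖p‖ < R →
      ‖T p - T z - deriv T z * (p - z)‖ ≤ L * ‖p - z‖ ^ 2 := by
    have e1 : ∀ᶠ z in 𝓝 (0 : ℂ), ‖T z‖ ≤ ‖T 0‖ + 1 :=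
      (hT.continuousAt.norm.eventually_lt_const (lt_add_one _)).mono fun _ => le_of_lt
    obtain ⟨R, hR, hR'⟩ := Metric.eventually_nhds_iff_ball.1
      (e1.and hT.eventually_analyticAt)
    refine ⟨(‖T 0‖ + 1) / (R / 4) / (R / 8), by positivity, R / 4, by positivity, fun z p hz hp => ?_⟩
    exact norm_sub_sub_deriv_mul_le hR
      (fun w hw => (hR' w hw).2.differentiableAt.differentiableWithinAt)
      (fun w hw => (hR' w hw).1) (by simpa using hz) (by simpa using hp)
  -- `T' z` and `(T z / z) ^ (m + 1)` agree up to `O(zᵐ⁺¹)`.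
  let y : ℂ → ℂ := fun z => z ^ m * A z
  have hy : AnalyticAt ℂ y 0 := (analyticAt_id.pow m).mul hA
  have hy0 : y 0 = 0 := by simp [y, hm0]
  obtain ⟨ψ₂, hψ₂, hψe⟩ : ∃ ψ₂ : ℂ → ℂ, AnalyticAt ℂ ψ₂ 0 ∧
      ∀ y, (1 + y) ^ (m + 1) = 1 + (m + 1) * y + y ^ 2 * ψ₂ y := by
    have e0 : AnalyticAt ℂ (fun y : ℂ => (1 + y) ^ (m + 1)) 0 :=
      (analyticAt_const.add analyticAt_id).pow _
    obtain ⟨ψ₁, h1, h10, h1e⟩ := e0.exists_eq_add_mul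
    obtain ⟨ψ₂, h2, -, h2e⟩ := h1.exists_eq_add_mul
    refine ⟨ψ₂, h2, fun y => ?_⟩
    have e : HasDerivAt (fun y : ℂ => (1 + y) ^ (m + 1)) (m + 1) 0 := by
      have := ((hasDerivAt_id (0 : ℂ)).const_add 1).fun_pow (m + 1)
      simpa using this
    rw [e.deriv] at h10
    have := h1e y
    simp only [add_zero, one_pow] at this
    rw [this, h2e, h10]; ring
  let d : ℂ → ℂ := fun z => deriv A z - z ^ (m - 1) * A z ^ 2 * ψ₂ (y z)
  have hd : ContinuousAt d 0 := by
    have e1 : ContinuousAt (fun z => ψ₂ (y z)) 0 :=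
      ContinuousAt.comp (by rw [hy0]; exact hψ₂.continuousAt) hy.continuousAt
    exact hA.deriv.continuousAt.sub
      (((continuousAt_id.pow _).mul (hA.continuousAt.pow 2)).mul e1)
  have hTd : ∀ᶠ z in 𝓝 (0 : ℂ), deriv T z = (1 + y z) ^ (m + 1) + z ^ (m + 1) * d z := by
    filter_upwards [hTA.eventually_nhds, hA.eventually_analyticAt] with z h1 h2
    have e : HasDerivAt (fun z => z + z ^ (m + 1) * A z)
        (1 + (((m + 1 : ℕ) : ℂ) * z ^ m * A z + z ^ (m + 1) * deriv A z)) z := by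
      have := (hasDerivAt_id z).fun_add
        ((hasDerivAt_pow (m + 1) z).fun_mul h2.differentiableAt.hasDerivAt)
      simpa using this
    rw [Filter.EventuallyEq.deriv_eq h1, e.deriv, hψe]
    simp only [y, d]
    obtain ⟨k, rfl⟩ := Nat.exists_eq_add_of_le' hm
    simp only [Nat.add_sub_cancel]
    push_cast
    ring
  have hdb : ∀ᶠ z in 𝓝 (0 : ℂ), ‖d z‖ ≤ ‖d 0‖ + 1 :=
    (hd.norm.eventually_lt_const (lt_add_one _)).mono fun _ => le_of_lt
  set B := ‖d 0‖ + 1 with hB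
  have hB0 : 0 < B := by positivity
  have hyb : ∀ᶠ z in 𝓝 (0 : ℂ), 1 / 2 < ‖1 + y z‖ ^ (m + 1) := by
    have e : ContinuousAt (fun z => ‖1 + y z‖ ^ (m + 1)) 0 :=
      (continuousAt_const.add hy.continuousAt).norm.pow _
    exact continuousAt_const.eventually_lt e (by simp [hy0]; norm_num)
  have hR1 : ∀ᶠ z in 𝓝 (0 : ℂ), 2 * ‖z‖ < min R 1 := by
    have e : ContinuousAt (fun z : ℂ => 2 * ‖z‖) 0 := by fun_prop
    exact e.eventually_lt continuousAt_const (by simp [hR])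
  refine ⟨2 * (B + L), by positivity, ?_⟩
  filter_upwards [hTA, hTd, hdb, hyb, hR1] with z h1 h2 h3 h4 h5 p hp
  have hzR := lt_of_lt_of_le h5 (min_le_left _ _)
  have hz1 := lt_of_lt_of_le h5 (min_le_right _ _)
  have hz0 := norm_nonneg z
  have hpow : ‖z‖ ^ (m + 1) ≤ ‖z‖ := pow_le_of_le_one hz0 (by linarith) (by omega)
  have hpR : ‖p‖ < R := by
    have := norm_le_insert' p z
    linarith
  have hT1 : T z = z * (1 + y z) := by rw [h1]; simp only [y]; ring
  have key : ‖T p - T z‖ ≤ ‖p - z‖ * (‖1 + y z‖ ^ (m + 1) + (B + L) * ‖z‖ ^ (m + 1)) := by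
    have e1 := norm_le_insert' (T p - T z) (deriv T z * (p - z))
    have e2 := hL z p (by linarith) hpR
    have e3 : ‖deriv T z‖ ≤ ‖1 + y z‖ ^ (m + 1) + ‖z‖ ^ (m + 1) * B := by
      rw [h2]
      refine (norm_add_le _ _).trans ?_
      rw [norm_mul, norm_pow, norm_pow]
      gcongr
    calc _ ≤ ‖deriv T z‖ * ‖p - z‖ + L * ‖p - z‖ ^ 2 := by
          rw [norm_mul] at e1; linarith
      _ ≤ (‖1 + y z‖ ^ (m + 1) + ‖z‖ ^ (m + 1) * B) * ‖p - z‖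
          + L * (‖p - z‖ * ‖z‖ ^ (m + 1)) := by
          rw [pow_two]; gcongr
      _ = _ := by ring
  have hTn : ‖T z‖ = ‖z‖ * ‖1 + y z‖ := by rw [hT1, norm_mul]
  rw [hTn, mul_pow]
  set t := ‖1 + y z‖ ^ (m + 1) with ht
  set s := ‖z‖ ^ (m + 1) with hs
  have hs0 : 0 ≤ s := by positivity
  have hts : t + (B + L) * s ≤ t * (1 + 2 * (B + L) * s) := by
    have : 0 ≤ (B + L) * s := by positivity
    nlinarith
  calc ‖T p - T z‖ * s ≤ ‖p - z‖ * (t + (B + L) * s) * s := by gcongr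
    _ ≤ ‖p - z‖ * (t * (1 + 2 * (B + L) * s)) * s := by gcongr
    _ = _ := by ring

/-- If a closed set is forward invariant under a germ `T` tangent to the identity and is dense, up
to a small fraction of the step of `T`, at a sequence of scales tending to `0`, then it contains a
repelling sector. A point `z` of the sector is approached by pulling it back along the inverse
branch to a good scale, choosing a nearby point of the set there and pushing it forward. -/
lemma eventually_repellingSector_mem {T A : ℂ → ℂ} {K : Set ℂ} {m : ℕ} (hm : 1 ≤ m)
    (hT : AnalyticAt ℂ T 0) (hT0 : T 0 = 0) (hT1 : deriv T 0 = 1)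
    (hA : AnalyticAt ℂ A 0) (ha : A 0 ≠ 0) (hTA : ∀ᶠ z in 𝓝 0, T z = z + z ^ (m + 1) * A z)
    (hK : IsClosed K) (hTK : ∀ᶠ z in 𝓝 0, z ∈ K → T z ∈ K)
    (hdense : ∀ η > 0, ∀ ε > 0, ∃ r : ℝ, 0 < r ∧ r < ε ∧ ∀ z : ℂ, r / 2 ≤ ‖z‖ → ‖z‖ ≤ r →
      ∃ p ∈ K, ‖p - z‖ ≤ η * ‖z‖ ^ (m + 1)) :
    ∀ᶠ z in 𝓝 (0 : ℂ), z ≠ 0 → InRepellingSector (A 0) m z → z ∈ K := by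
  obtain ⟨S, hS, hS0, hS1, -, hTS⟩ :=
    hT.exists_local_inverse hT0 (by rw [hT1]; exact one_ne_zero)
  rw [hT1, inv_one] at hS1
  obtain ⟨c, hc, hsec⟩ := eventually_repellingSector_inverse hm hA ha hTA hS hS0 hS1 hTS
  obtain ⟨C, hC, hcon⟩ := eventually_norm_sub_mul_le hm hT hA hTA
  have tS : Tendsto S (𝓝 0) (𝓝 0) := by simpa [hS0] using hS.continuousAt.tendsto
  obtain ⟨ρ, hρ, hall⟩ := Metric.eventually_nhds_iff.1
    (hsec.and (hTS.and ((tS.eventually hcon).and hTK)))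
  simp only [dist_zero_right] at hall
  -- The weight absorbing the accumulated distortion along an orbit of `S`.
  set b := C / c with hb
  have hb0 : 0 < b := by positivity
  have hsmall : ∀ᶠ z in 𝓝 (0 : ℂ), 2 * ‖z‖ < min ρ 1 := by
    have e : ContinuousAt (fun z : ℂ => 2 * ‖z‖) 0 := by fun_prop
    exact e.eventually_lt continuousAt_const (by simp [hρ])
  filter_upwards [hsmall] with z hz hz0 hzs
  have hzρ := lt_of_lt_of_le hz (min_le_left _ _)
  have hz1 := lt_of_lt_of_le hz (min_le_right _ _)
  have hstep : ∀ w : ℂ, ‖w‖ ≤ ‖z‖ → w ≠ 0 → InRepellingSector (A 0) m w →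
      ‖S w‖ ≤ ‖z‖ ∧ S w ≠ 0 ∧ InRepellingSector (A 0) m (S w) ∧
      ‖S w‖ ≤ ‖w‖ - c * ‖w‖ ^ (m + 1) ∧ ‖w‖ / 2 ≤ ‖S w‖ := by
    intro w hw hw0 hws
    obtain ⟨h1, h2, h3⟩ := (@hall w (by linarith [norm_nonneg z])).1 hw0 hws
    have hwp : 0 < ‖w‖ := norm_pos_iff.2 hw0
    have : 0 ≤ c * ‖w‖ ^ (m + 1) := by positivity
    exact ⟨by linarith, by rw [← norm_pos_iff]; linarith, h1, h2, h3⟩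
  have horb : ∀ k : ℕ, ‖S^[k] z‖ ≤ ‖z‖ ∧ S^[k] z ≠ 0 ∧ InRepellingSector (A 0) m (S^[k] z) := by
    intro k
    induction k with
    | zero => exact ⟨le_rfl, hz0, hzs⟩
    | succ k ih =>
      rw [Function.iterate_succ_apply']
      obtain ⟨h1, h2, h3, -⟩ := hstep _ ih.1 ih.2.1 ih.2.2
      exact ⟨h1, h2, h3⟩
  have hsmall_k : ∀ r > 0, ∃ k, ‖S^[k] z‖ ≤ r := by
    intro r hr
    by_contra! hcon'
    have hdec : ∀ k : ℕ, ‖S^[k] z‖ ≤ ‖z‖ - k * (c * r ^ (m + 1)) := by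
      intro k
      induction k with
      | zero => simp
      | succ k ih =>
        obtain ⟨-, -, -, h4, -⟩ := hstep _ (horb k).1 (horb k).2.1 (horb k).2.2
        rw [Function.iterate_succ_apply']
        have : c * r ^ (m + 1) ≤ c * ‖S^[k] z‖ ^ (m + 1) := by
          have := (hcon' k).le
          gcongr
        push_cast
        linarith
    obtain ⟨k, hk⟩ := exists_nat_gt (‖z‖ / (c * r ^ (m + 1)))
    rw [div_lt_iff₀ (by positivity)] at hk
    linarith [hdec k, norm_nonneg (S^[k] z)]
  rw [← hK.closure_eq, Metric.mem_closure_iff]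
  intro ε hε
  have hexp : 0 < Real.exp (b * ‖z‖) := Real.exp_pos _
  obtain ⟨η, hη, hη1, hηε⟩ : ∃ η, 0 < η ∧ η * Real.exp (b * ‖z‖) ≤ 1 ∧
      η * Real.exp (b * ‖z‖) < ε := by
    refine ⟨min 1 (ε / 2) / Real.exp (b * ‖z‖), by positivity, ?_, ?_⟩
    · rw [div_mul_cancel₀ _ hexp.ne']; exact min_le_left _ _
    · rw [div_mul_cancel₀ _ hexp.ne']
      exact lt_of_le_of_lt (min_le_right _ _) (by linarith)
  -- Being approximated by the set is inherited forward along the orbit.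
  have hback : ∀ w : ℂ, ‖w‖ ≤ ‖z‖ → w ≠ 0 → InRepellingSector (A 0) m w →
      (∃ p ∈ K, ‖p - S w‖ ≤ η * Real.exp (b * ‖S w‖) * ‖S w‖ ^ (m + 1)) →
      ∃ p ∈ K, ‖p - w‖ ≤ η * Real.exp (b * ‖w‖) * ‖w‖ ^ (m + 1) := by
    rintro w hw hw0 hws ⟨p, hpK, hp⟩
    obtain ⟨h1, h2, h3, h4, h5⟩ := hstep w hw hw0 hws
    obtain ⟨-, hTSw, hconw, -⟩ := @hall w (by linarith [norm_nonneg z])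
    have hSpos : 0 < ‖S w‖ := norm_pos_iff.2 h2
    have hη2 : η * Real.exp (b * ‖S w‖) ≤ 1 := by
      refine le_trans ?_ hη1
      gcongr
    have hp' : ‖p - S w‖ ≤ ‖S w‖ ^ (m + 1) :=
      hp.trans (mul_le_of_le_one_left (by positivity) hη2)
    have hpn : ‖p‖ < ρ := by
      have e1 := norm_le_insert' p (S w)
      have e2 : ‖S w‖ ^ (m + 1) ≤ ‖S w‖ :=
        pow_le_of_le_one hSpos.le (by linarith) (by omega)
      linarith
    refine ⟨T p, (hall hpn).2.2.2 hpK, ?_⟩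
    have e := hconw p hp'
    rw [hTSw] at e
    have hmon : c * ‖S w‖ ^ (m + 1) ≤ ‖w‖ - ‖S w‖ := by
      have hle : ‖S w‖ ≤ ‖w‖ := by
        have : 0 ≤ c * ‖w‖ ^ (m + 1) := by positivity
        linarith
      have : c * ‖S w‖ ^ (m + 1) ≤ c * ‖w‖ ^ (m + 1) := by gcongr
      linarith
    have hfac : 1 + C * ‖S w‖ ^ (m + 1) ≤ Real.exp (b * (‖w‖ - ‖S w‖)) := by
      have e1 : C * ‖S w‖ ^ (m + 1) ≤ b * (‖w‖ - ‖S w‖) := by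
        calc C * ‖S w‖ ^ (m + 1) = b * (c * ‖S w‖ ^ (m + 1)) := by rw [hb]; field_simp
          _ ≤ _ := by gcongr
      linarith [Real.add_one_le_exp (b * (‖w‖ - ‖S w‖))]
    have hspos : 0 < ‖S w‖ ^ (m + 1) := by positivity
    refine le_of_mul_le_mul_right (e.trans ?_) hspos
    calc _ ≤ (η * Real.exp (b * ‖S w‖) * ‖S w‖ ^ (m + 1)) * ‖w‖ ^ (m + 1)
          * Real.exp (b * (‖w‖ - ‖S w‖)) := by gcongr
      _ = η * (Real.exp (b * ‖S w‖) * Real.exp (b * (‖w‖ - ‖S w‖))) * ‖w‖ ^ (m + 1)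
          * ‖S w‖ ^ (m + 1) := by ring
      _ = _ := by rw [← Real.exp_add]; ring_nf
  obtain ⟨r, hr, hrz, hrd⟩ := hdense η hη ‖z‖ (norm_pos_iff.2 hz0)
  -- The first time the orbit reaches the good scale `r`.
  have hex := hsmall_k r hr
  classical
  obtain ⟨k, hk⟩ : ∃ k, Nat.find hex = k + 1 := by
    refine Nat.exists_eq_succ_of_ne_zero fun h0 => ?_
    have := Nat.find_spec hex
    rw [h0] at this
    exact absurd this (not_le.2 hrz)
  have hk1 : ‖S^[k + 1] z‖ ≤ r := by rw [← hk]; exact Nat.find_spec hex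
  have hk2 : r < ‖S^[k] z‖ := not_le.1 (Nat.find_min hex (by omega))
  have hk3 : r / 2 ≤ ‖S^[k + 1] z‖ := by
    rw [Function.iterate_succ_apply']
    have := (hstep _ (horb k).1 (horb k).2.1 (horb k).2.2).2.2.2.2
    linarith
  have hgood : ∀ i, ∃ p ∈ K, ‖p - S^[k + 1 - i] z‖ ≤
      η * Real.exp (b * ‖S^[k + 1 - i] z‖) * ‖S^[k + 1 - i] z‖ ^ (m + 1) := by
    intro i
    induction i with
    | zero =>
      obtain ⟨p, hpK, hp⟩ := hrd _ hk3 hk1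
      refine ⟨p, hpK, hp.trans ?_⟩
      have : 1 ≤ Real.exp (b * ‖S^[k + 1] z‖) := Real.one_le_exp (by positivity)
      simp only [Nat.sub_zero]
      gcongr
      exact le_mul_of_one_le_right hη.le this
    | succ i ih =>
      rcases Nat.lt_or_ge i (k + 1) with hi | hi
      · have e : k + 1 - i = (k + 1 - (i + 1)) + 1 := by omega
        rw [e, Function.iterate_succ_apply'] at ih
        exact hback _ (horb _).1 (horb _).2.1 (horb _).2.2 ih
      · have e : k + 1 - (i + 1) = k + 1 - i := by omega
        rw [e]; exact ih
  obtain ⟨p, hpK, hp⟩ := hgood (k + 1)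
  simp only [Nat.sub_self, Function.iterate_zero, id] at hp
  refine ⟨p, hpK, ?_⟩
  rw [dist_comm, dist_eq_norm]
  refine lt_of_le_of_lt (hp.trans (mul_le_of_le_one_right (by positivity) ?_)) hηε
  exact pow_le_one₀ (norm_nonneg _) (by linarith)

/-! ### Spreading the sector by rotation, and the main argument -/

/-- A set that contains a repelling sector and is invariant under an irrationally indifferent germ
is a neighbourhood of `0`: finitely many iterates of the germ rotate the sector over all
directions. -/
lemma mem_nhds_of_repellingSector_subset {f : ℂ → ℂ} {K : Set ℂ} {α : ℝ} {a : ℂ} {m : ℕ}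
    (hα : Irrational α) (hf : AnalyticAt ℂ f 0) (hf0 : f 0 = 0)
    (hl : deriv f 0 = Complex.exp (2 * Real.pi * Complex.I * α)) (hm : 1 ≤ m) (ha : a ≠ 0)
    (h0K : (0 : ℂ) ∈ K) (hfK : ∀ᶠ z in 𝓝 0, z ∈ K → f z ∈ K)
    (hsec : ∀ᶠ z in 𝓝 (0 : ℂ), z ≠ 0 → InRepellingSector a m z → z ∈ K) : K ∈ 𝓝 (0 : ℂ) := by
  set l := Complex.exp (2 * Real.pi * Complex.I * α) with hldef
  have hl1 : ‖l‖ = 1 := norm_exp_two_pi_I_mul α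
  have hl0 : l ≠ 0 := Complex.exp_ne_zero _
  obtain ⟨g, hg, hg0, hg1, -, hfg⟩ := hf.exists_local_inverse hf0 (by rw [hl]; exact hl0)
  rw [hl] at hg1
  have tg : Tendsto g (𝓝 0) (𝓝 0) := by simpa [hg0] using hg.continuousAt.tendsto
  have tgj : ∀ j : ℕ, Tendsto g^[j] (𝓝 0) (𝓝 0) := fun j => tg.iterate j
  -- A central direction of the sector, and an open cone around it.
  obtain ⟨u₀, hu₀, hau₀⟩ : ∃ u₀ : ℂ, ‖u₀‖ = 1 ∧ a * u₀ ^ m = ‖a‖ := by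
    obtain ⟨u₀, hu⟩ := IsAlgClosed.exists_pow_nat_eq ((‖a‖ : ℂ) / a) (n := m) (by omega)
    have han : ‖a‖ ≠ 0 := norm_ne_zero_iff.2 ha
    refine ⟨u₀, ?_, by rw [hu]; field_simp⟩
    have : ‖u₀‖ ^ m = 1 := by
      rw [← norm_pow, hu, norm_div, Complex.norm_real, norm_norm, div_self han]
    exact (pow_eq_one_iff_of_nonneg (norm_nonneg _) (by omega)).1 this
  have hu₀0 : u₀ ≠ 0 := by rw [← norm_pos_iff, hu₀]; exact one_pos
  obtain ⟨δ, hδ, hcone⟩ : ∃ δ > 0, ∀ u : ℂ, ‖u - u₀‖ < δ → InRepellingSector a m u := by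
    have e : ∀ᶠ u in 𝓝 u₀, ‖a * u ^ m‖ / 2 < (a * u ^ m).re := by
      have c1 : Continuous fun u : ℂ => ‖a * u ^ m‖ / 2 := by fun_prop
      have c2 : Continuous fun u : ℂ => (a * u ^ m).re :=
        Complex.continuous_re.comp (by fun_prop)
      refine c1.continuousAt.eventually_lt c2.continuousAt ?_
      have : 0 < ‖a‖ := norm_pos_iff.2 ha
      rw [hau₀]
      simp only [Complex.norm_real, norm_norm, Complex.ofReal_re]
      linarith
    obtain ⟨δ, hδ, h⟩ := Metric.eventually_nhds_iff.1 e
    exact ⟨δ, hδ, fun u hu => (h (by rwa [dist_eq_norm])).le⟩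
  have hscale : ∀ (t : ℝ) (u : ℂ), 0 ≤ t → InRepellingSector a m u →
      InRepellingSector a m (t * u) := by
    intro t u ht hu
    unfold InRepellingSector at hu ⊢
    have e : a * (t * u) ^ m = ((t ^ m : ℝ) : ℂ) * (a * u ^ m) := by push_cast; ring
    rw [e, Complex.re_ofReal_mul, norm_mul, Complex.norm_real, Real.norm_of_nonneg (by positivity)]
    have : 0 ≤ t ^ m := by positivity
    nlinarith
  obtain ⟨q, hNq, hq0, hq⟩ := hα.exists_dense_powers (⌈4 * Real.pi / (δ / 2)⌉₊ + 1)
  have hq0' : (0 : ℝ) < q := by exact_mod_cast hq0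
  have hqδ : 4 * Real.pi / q < δ / 2 := by
    rw [div_lt_iff₀ hq0', ← div_lt_iff₀' (by positivity)]
    calc _ ≤ (⌈4 * Real.pi / (δ / 2)⌉₊ : ℝ) := Nat.le_ceil _
      _ < q := by exact_mod_cast hNq
  have hlin : ∀ j : ℕ, ∀ᶠ z in 𝓝 (0 : ℂ), ‖g^[j] z - l⁻¹ ^ j * z‖ ≤ δ / 2 * ‖z‖ := by
    intro j
    have e : HasDerivAt g^[j] (l⁻¹ ^ j) 0 := by
      have := hg.differentiableAt.hasDerivAt
      rw [hg1] at this
      exact this.iterate (x := 0) hg0 j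
    have e2 := (hasDerivAt_iff_isLittleO.1 e).bound (by positivity : (0 : ℝ) < δ / 2)
    filter_upwards [e2] with z hz
    simpa [Function.iterate_fixed hg0, mul_comm] using hz
  have hback : ∀ j : ℕ, ∀ᶠ z in 𝓝 (0 : ℂ), g^[j] z ∈ K → z ∈ K := by
    intro j
    induction j with
    | zero => exact Eventually.of_forall fun z hz => hz
    | succ j ih =>
      filter_upwards [tg.eventually ih, hfg, tg.eventually hfK] with z h1 h2 h3 h4
      rw [← h2]
      exact h3 (h1 h4)
  have hfin : ∀ᶠ z in 𝓝 (0 : ℂ), ∀ j ∈ Set.Iio q, ‖g^[j] z - l⁻¹ ^ j * z‖ ≤ δ / 2 * ‖z‖ ∧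
      (g^[j] z ∈ K → z ∈ K) ∧ (g^[j] z ≠ 0 → InRepellingSector a m (g^[j] z) → g^[j] z ∈ K) :=
    ((Set.finite_Iio q).eventually_all).2 fun j _ =>
      (hlin j).and ((hback j).and ((tgj j).eventually hsec))
  filter_upwards [hfin] with z hz
  by_cases hz0 : z = 0
  · rw [hz0]; exact h0K
  have hzpos : 0 < ‖z‖ := norm_pos_iff.2 hz0
  have hzc : (‖z‖ : ℂ) ≠ 0 := by exact_mod_cast hzpos.ne'
  obtain ⟨j, hjq, hj⟩ := hq (z / (‖z‖ * u₀)) (by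
    rw [norm_div, norm_mul, Complex.norm_real, norm_norm, hu₀, mul_one, div_self hzpos.ne'])
  obtain ⟨h1, h2, h3⟩ := hz j hjq
  refine h2 ?_
  by_cases hgz : g^[j] z = 0
  · rw [hgz]; exact h0K
  refine h3 hgz ?_
  have e : g^[j] z = (‖z‖ : ℝ) * (g^[j] z / ‖z‖) := by field_simp
  rw [e]
  refine hscale _ _ hzpos.le (hcone _ ?_)
  have e1 : ‖(g^[j] z - l⁻¹ ^ j * z) / ‖z‖‖ ≤ δ / 2 := by
    rw [norm_div, Complex.norm_real, norm_norm, div_le_iff₀ hzpos]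
    exact h1
  have e2 : ‖l⁻¹ ^ j * z / ‖z‖ - u₀‖ < δ / 2 := by
    have : l⁻¹ ^ j * z / ‖z‖ - u₀ = -(l⁻¹ ^ j * u₀ * (l ^ j - z / (‖z‖ * u₀))) := by
      rw [inv_pow]; field_simp; ring
    rw [this, norm_neg, norm_mul, norm_mul, norm_pow, norm_inv, hl1, hu₀, inv_one, one_pow,
      one_mul, one_mul]
    exact lt_of_le_of_lt hj hqδ
  calc _ = ‖(g^[j] z - l⁻¹ ^ j * z) / ‖z‖ + (l⁻¹ ^ j * z / ‖z‖ - u₀)‖ := by congr 1; ring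
    _ ≤ _ := norm_add_le _ _
    _ < δ := by linarith

/-- A germ tangent to the identity that is not the identity has the form `z + zᵐ⁺¹ A(z)` with
`m ≥ 1` and `A(0) ≠ 0`. -/
lemma exists_eq_add_pow_mul {T : ℂ → ℂ} (hT : AnalyticAt ℂ T 0) (hT0 : T 0 = 0)
    (hT1 : deriv T 0 = 1) (hne : ¬ ∀ᶠ z in 𝓝 (0 : ℂ), T z = z) :
    ∃ (m : ℕ) (A : ℂ → ℂ), 1 ≤ m ∧ AnalyticAt ℂ A 0 ∧ A 0 ≠ 0 ∧
      ∀ᶠ z in 𝓝 (0 : ℂ), T z = z + z ^ (m + 1) * A z := by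
  have hd : AnalyticAt ℂ (fun z => T z - z) 0 := hT.sub analyticAt_id
  obtain ⟨n, A, hA, hA0, hTA⟩ := hd.exists_eventuallyEq_pow_smul_nonzero_iff.2 (fun h =>
    hne (h.mono fun z hz => sub_eq_zero.1 hz))
  simp only [sub_zero, smul_eq_mul] at hTA
  have hn : 2 ≤ n := by
    by_contra! hlt
    interval_cases n
    · have := hTA.self_of_nhds
      simp [hT0] at this
      exact hA0 this.symm
    · have e1 : deriv (fun z => T z - z) 0 = 0 := by
        have := hT.differentiableAt.hasDerivAt.fun_sub (hasDerivAt_id (0 : ℂ))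
        rw [hT1, sub_self] at this
        exact this.deriv
      have e2 : HasDerivAt (fun z => z ^ 1 * A z) (A 0) 0 := by
        have := (hasDerivAt_pow 1 (0 : ℂ)).fun_mul hA.differentiableAt.hasDerivAt
        simpa using this
      rw [Filter.EventuallyEq.deriv_eq hTA, e2.deriv] at e1
      exact hA0 e1
  refine ⟨n - 1, A, by omega, hA, hA0, ?_⟩
  filter_upwards [hTA] with z hz
  rw [Nat.sub_add_cancel (by omega), ← hz]
  ring

/-- Local form of the theorem: a closed connected set through `0`, locally invariant under an
irrationally indifferent germ and forward invariant under a nontrivial germ tangent to the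
identity, is a neighbourhood of `0`. -/
lemma mem_nhds_of_forward_invariant {f T : ℂ → ℂ} {K : Set ℂ}
    (hf : IsIrrationallyIndifferentGerm f) (hK : IsConnected K) (hKc : IsClosed K)
    (h0K : (0 : ℂ) ∈ K) (hK1 : ∃ z ∈ K, z ≠ 0) (hfK : ∀ᶠ z in 𝓝 0, z ∈ K → f z ∈ K)
    (hT : AnalyticAt ℂ T 0) (hT0 : T 0 = 0) (hT1 : deriv T 0 = 1)
    (hTK : ∀ᶠ z in 𝓝 0, z ∈ K → T z ∈ K) (hne : ¬ ∀ᶠ z in 𝓝 (0 : ℂ), T z = z) :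
    K ∈ 𝓝 (0 : ℂ) := by
  obtain ⟨hfa, hf0, α, hα, hl⟩ := hf
  obtain ⟨m, A, hm, hA, hA0, hTA⟩ := exists_eq_add_pow_mul hT hT0 hT1 hne
  refine mem_nhds_of_repellingSector_subset hα hfa hf0 hl hm hA0 h0K hfK ?_
  exact eventually_repellingSector_mem hm hT hT0 hT1 hA hA0 hTA hKc hTK fun η hη ε hε =>
    exists_scale_dense hα hfa hf0 hl hK h0K hK1 hfK (m + 1) (by omega) hη hε

/-- Let `K` be a hedgehog of a nonlinearizable germ `f`, and let `T(z) = z + O(z²)` be a germ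
tangent to the identity with a univalent extension `F` to a neighbourhood of `K`.  If `K` is forward
invariant (`T(K) ⊆ K`) or backward invariant (`T⁻¹(K) ⊆ K`, that is, `K ⊆ T(K)`), then `T` is the
identity germ. -/
theorem theorem3p1 (f : ℂ → ℂ) (K : Set ℂ)
    (hf : IsIrrationallyIndifferentGerm f) (hnl : ¬ IsLinearizableGerm f)
    (hK : IsHedgehog f K)
    (T : ℂ → ℂ) (hT : AnalyticAt ℂ T 0) (hT0 : T 0 = 0) (hT1 : deriv T 0 = 1)
    (F : ℂ → ℂ) (hF : IsUnivalentExtensionNear T F K)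
    (hinv : F '' K ⊆ K ∨ K ⊆ F '' K) :
    ∀ᶠ z in 𝓝 (0 : ℂ), T z = z := by
  obtain ⟨-, ⟨hKc, hKconn, -, h0K, Φ, -, -, -, ⟨hΦf, V, hV, hKV, hΦd, -⟩, -, hΦK, -⟩, -⟩ := hK
  obtain ⟨hFT, U, hU, hKU, hFd, hFinj⟩ := hF
  have h0 : (0 : ℂ) ∈ K := h0K.subset rfl
  have hK1 : ∃ z ∈ K, z ≠ 0 := by
    obtain ⟨z, hz, hz0⟩ := Set.exists_of_ssubset h0K
    exact ⟨z, hz, hz0⟩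
  have hfK : ∀ᶠ z in 𝓝 (0 : ℂ), z ∈ K → f z ∈ K := by
    filter_upwards [hΦf] with z hz hzK
    rw [← hz, ← hΦK]
    exact mem_image_of_mem Φ hzK
  have hnotnhds : K ∉ 𝓝 (0 : ℂ) := by
    intro hnhds
    obtain ⟨-, hf0, α, -, hl⟩ := hf
    exact hnl (isLinearizableGerm_of_mem_interior hf0 hl (norm_exp_two_pi_I_mul α) hΦf hKc hV hKV
      hΦd (mapsTo_iff_image_subset.2 hΦK.subset) hnhds)
  rcases hinv with hinv | hinv
  · by_contra hne
    refine hnotnhds (mem_nhds_of_forward_invariant hf hKconn hKc.isClosed h0 hK1 hfK hT hT0 hT1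
      ?_ hne)
    filter_upwards [hFT] with z hz hzK
    rw [← hz]
    exact hinv (mem_image_of_mem F hzK)
  · -- In the backward case, univalence makes `K` forward invariant under the inverse germ.
    obtain ⟨S, hS, hS0, hS1, hST, hTS⟩ :=
      hT.exists_local_inverse hT0 (by rw [hT1]; exact one_ne_zero)
    rw [hT1, inv_one] at hS1
    have tS : Tendsto S (𝓝 0) (𝓝 0) := by simpa [hS0] using hS.continuousAt.tendsto
    have tT : Tendsto T (𝓝 0) (𝓝 0) := by simpa [hT0] using hT.continuousAt.tendsto
    have hSid : ∀ᶠ z in 𝓝 (0 : ℂ), S z = z := by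
      by_contra hne
      refine hnotnhds (mem_nhds_of_forward_invariant hf hKconn hKc.isClosed h0 hK1 hfK hS hS0 hS1
        ?_ hne)
      filter_upwards [hTS, tS.eventually hFT, tS.eventually (hU.mem_nhds (hKU h0))]
        with z h1 h2 h3 hzK
      obtain ⟨w, hwK, hw⟩ := hinv hzK
      have : S z = w := hFinj h3 (hKU hwK) (by rw [h2, h1, hw])
      rw [this]
      exact hwK
    filter_upwards [hST, tT.eventually hSid] with z h1 h2
    rw [← h2, h1]
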